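/- A numerical semigroup is a submonoid $H\subseteq\mathbb N$ with $|\mathbb N\setminus H|<\infty$. Its set of pseudo-Frobenius numbers is $PF(H)=\{x\in\mathbb Z\setminus H : x+h\in H \text{ for all } h\in H,\ h>0\}$, and its (arithmetic) type is $\operatorname{type}(H)=|PF(H)|$. For a field $K$, the semigroup ring $K[H]$ is the $K$-subalgebra of the polynomial ring $K[t]$ generated by the monomials $t^h$, $h\in H$. The type of a Cohen–Macaulay local ring $(R,\mathfrak m)$ of Krull dimension $d$ is $\operatorname{type}(R)=\dim_{R/\mathfrak m}\operatorname{Ext}_R^d(R/\mathfrak m,R)$, and the type of a Cohen–Macaulay ring $R$ is the maximum of $\operatorname{type}(R_{\mathfrak p})$ over the maximal ideals $\mathfrak p$ of $R$. **Theorem.** Let $K$ be any field and $H$ any numerical semigroup. Then $PF(H)$ is finite, $K[H]$ is a Cohen–Macaulay ring, and $$\operatorname{type}(H)=|PF(H)|=\operatorname{type}(K[H]).$$ -/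

import Mathlib

open CategoryTheory

noncomputable section

universe u

/-- A submonoid of `ℕ` is a numerical semigroup if it has finite complement. -/
def IsNumericalSemigroup (H : AddSubmonoid ℕ) : Prop :=
  ((H : Set ℕ)ᶜ).Finite

/-- The set `PF(H)` of pseudo-Frobenius numbers: the integers `x ∉ H` with `x + h ∈ H` for all
`h ∈ H`, `h > 0`. Here `H` is regarded as a subset of `ℤ`. -/
def pseudoFrobenius (H : AddSubmonoid ℕ) : Set ℤ :=
  {x : ℤ | x ∉ ((↑) : ℕ → ℤ) '' (H : Set ℕ) ∧
    ∀ h ∈ H, 0 < h → x + (h : ℤ) ∈ ((↑) : ℕ → ℤ) '' (H : Set ℕ)}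

/-- The (arithmetic) type of `H`: the number of pseudo-Frobenius numbers. -/
def numericalSemigroupType (H : AddSubmonoid ℕ) : ℕ :=
  (pseudoFrobenius H).ncard

/-- The semigroup ring `K[H]`: the `K`-subalgebra of `K[t]` generated by the monomials `t ^ h`
with `h ∈ H`. -/
def semigroupRing (K : Type u) [Field K] (H : AddSubmonoid ℕ) : Subalgebra K (Polynomial K) :=
  Algebra.adjoin K {f | ∃ h ∈ H, f = (Polynomial.X : Polynomial K) ^ h}

section LocalRings

variable (R : Type u) [CommRing R] [IsLocalRing R]

/-- The depth of a local ring: the supremum of the lengths of the `R`-regular sequences contained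
in the maximal ideal. -/
def localDepth : ℕ∞ :=
  ⨆ rs : {rs : List R //
    (∀ r ∈ rs, r ∈ IsLocalRing.maximalIdeal R) ∧ RingTheory.Sequence.IsRegular R rs},
      (rs.1.length : ℕ∞)

/-- A Cohen–Macaulay local ring: Noetherian, with depth equal to the Krull dimension. -/
def IsCohenMacaulayLocalRing : Prop :=
  IsNoetherianRing R ∧ (localDepth R : WithBot ℕ∞) = ringKrullDim R

/-- The `R`-module `Ext_R^i(k, R)`, where `k` is the residue field of `R`. -/
abbrev residueExt (i : ℕ) : Type u :=
  Abelian.Ext (ModuleCat.of R (IsLocalRing.ResidueField R)) (ModuleCat.of R R) i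

/-- `Ext_R^i(k, R)` is annihilated by the maximal ideal of `R`. -/
theorem residueExt_isTorsionBySet (i : ℕ) :
    Module.IsTorsionBySet R (residueExt R i) (IsLocalRing.maximalIdeal R : Set R) := by
  intro e r
  have h0 : (r : R) • 𝟙 (ModuleCat.of R (IsLocalRing.ResidueField R)) = 0 := by
    ext x
    obtain ⟨y, rfl⟩ := IsLocalRing.residue_surjective x
    have hr : IsLocalRing.residue R (r : R) = 0 := (IsLocalRing.residue_eq_zero_iff _).2 r.2
    change (r : R) • IsLocalRing.residue R y = 0
    rw [Algebra.smul_def]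
    change IsLocalRing.residue R (r : R) * _ = 0
    rw [hr, zero_mul]
  have h1 := Abelian.Ext.smul_comp (R := R)
    (Abelian.Ext.mk₀ (𝟙 (ModuleCat.of R (IsLocalRing.ResidueField R)))) e (zero_add i) (r : R)
  rw [← Abelian.Ext.mk₀_smul, h0, Abelian.Ext.mk₀_id_comp] at h1
  simpa using h1.symm

/-- The vector space structure on `Ext_R^i(k, R)` over the residue field `k = R ⧸ 𝔪`, through which
its `R`-module structure factors. -/
instance residueExtModule (i : ℕ) :
    Module (IsLocalRing.ResidueField R) (residueExt R i) :=
  (residueExt_isTorsionBySet R i).module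

/-- The type of a (Cohen–Macaulay) local ring: `dim_k Ext_R^d(k, R)`, with `k` the residue field and
`d` the Krull dimension of `R`. The dimension of a Noetherian local ring is a natural number, so
the conversion of `d` to `ℕ` loses nothing there. -/
def localType : ℕ∞ :=
  Cardinal.toENat (Module.rank (IsLocalRing.ResidueField R)
    (residueExt R ((ringKrullDim R).unbotD 0).toNat))

end LocalRings

/-- A Cohen–Macaulay ring: Noetherian, and all its localizations at maximal ideals are
Cohen–Macaulay local rings. -/
def IsCohenMacaulayRing (R : Type u) [CommRing R] : Prop :=
  IsNoetherianRing R ∧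
    ∀ p : MaximalSpectrum R, IsCohenMacaulayLocalRing (Localization.AtPrime p.asIdeal)

/-- The (Cohen–Macaulay) type of a Cohen–Macaulay ring: the maximum of the types of its
localizations at maximal ideals. It is written as a supremum in `ℕ∞`; for a nonzero ring a finite
supremum is attained. -/
def cohenMacaulayType (R : Type u) [CommRing R] : ℕ∞ :=
  ⨆ p : MaximalSpectrum R, localType (Localization.AtPrime p.asIdeal)

end

/-! `K[H]` is a Noetherian domain, not a field, over which `K[t]` is integral, so its localizations
at maximal ideals are one-dimensional domains, hence Cohen–Macaulay, and their type is `dim Ext¹(k,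
S)`.

For a local domain `S` and `0 ≠ a ∈ 𝔪`, the sequence `0 → S → S → S/aS → 0` gives `Ext¹(k, S) ≅
Hom(k, S/aS) ≅ (aS : 𝔪)/aS`: `Hom(k, S)` vanishes and `a` kills `Ext¹(k, S)`. This is
`rank_residueExt_one_eq`.

Fix `m > 0` with all `n ≥ m` in `H`. At the augmentation ideal take `a = t^m`. The socle of `S/aS`
is spanned by the monomials `t^n` with `n ∈ H`, `n - m ∉ H` and `n - m + h ∈ H` for all positive `h
∈ H`, that is, `n - m ∈ PF(H)` (`rank_residueExt_augmentationIdeal`). At any other maximal ideal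
`t^m` is a unit, the maximal ideal is principal as in `K[t]`, and the type is at most `1 ≤ |PF(H)|`.
So the maximum is attained at the augmentation ideal. -/

/-! ### `Ext¹(k, S)` as the socle of `S/aS` -/

section ExtComputation

open Pointwise

variable {S : Type u} [CommRing S] [IsLocalRing S]

/-- The elements of a local ring that the maximal ideal multiplies into the ideal `(a)`. -/
noncomputable def colonMaximal (a : S) : Ideal S where
  carrier := {y | ∀ s ∈ IsLocalRing.maximalIdeal S, a ∣ s * y}
  add_mem' := fun hx hy s hs => by rw [mul_add]; exact dvd_add (hx s hs) (hy s hs)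
  zero_mem' := fun s _ => by simp
  smul_mem' := fun c x hx s hs => by
    rw [smul_eq_mul, mul_left_comm]; exact Dvd.dvd.mul_left (hx s hs) c

omit [IsLocalRing S] in
theorem mem_smul_top_iff_dvd (a y : S) : y ∈ (a • (⊤ : Submodule S S)) ↔ a ∣ y := by
  simp [Submodule.mem_smul_pointwise_iff_exists, dvd_def, eq_comm]

/-- The map from the residue field to `S ⧸ a S` sending `1` to the class of `y`. -/
noncomputable def residueToQuotient (a : S) (y : colonMaximal a) :
    IsLocalRing.ResidueField S →ₗ[S] (S ⧸ (a • (⊤ : Submodule S S))) :=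
  Submodule.liftQ (IsLocalRing.maximalIdeal S)
    (LinearMap.toSpanSingleton S _ ((a • (⊤ : Submodule S S)).mkQ (y : S))) (by
      intro s hs
      rw [LinearMap.mem_ker, LinearMap.toSpanSingleton_apply, ← map_smul, Submodule.mkQ_apply,
        Submodule.Quotient.mk_eq_zero, mem_smul_top_iff_dvd]
      exact y.2 s hs)

theorem residueToQuotient_residue (a : S) (y : colonMaximal a) (s : S) :
    residueToQuotient a y (IsLocalRing.residue S s) =
      s • (a • (⊤ : Submodule S S)).mkQ (y : S) := rfl

theorem residue_linearMap_ext {M : Type*} [AddCommGroup M] [Module S M]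
    {f g : IsLocalRing.ResidueField S →ₗ[S] M}
    (h : f (IsLocalRing.residue S 1) = g (IsLocalRing.residue S 1)) : f = g := by
  ext x
  obtain ⟨s, rfl⟩ := IsLocalRing.residue_surjective x
  have : IsLocalRing.residue S s = s • IsLocalRing.residue S 1 := by
    rw [Algebra.smul_def]
    change _ = IsLocalRing.residue S s * _
    rw [map_one, mul_one]
  rw [this, map_smul, map_smul, h]

theorem exists_residueToQuotient_eq (a : S)
    (f : IsLocalRing.ResidueField S →ₗ[S] (S ⧸ (a • (⊤ : Submodule S S)))) :
    ∃ y, residueToQuotient a y = f := by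
  obtain ⟨y, hy⟩ := Submodule.mkQ_surjective _ (f (IsLocalRing.residue S 1))
  refine ⟨⟨y, fun s hs => ?_⟩, residue_linearMap_ext ?_⟩
  · rw [← mem_smul_top_iff_dvd, ← Submodule.Quotient.mk_eq_zero, ← smul_eq_mul,
      ← Submodule.mkQ_apply, map_smul, hy, ← map_smul, Algebra.smul_def]
    change f (IsLocalRing.residue S s * _) = 0
    rw [(IsLocalRing.residue_eq_zero_iff s).2 hs, zero_mul, map_zero]
  · rw [residueToQuotient_residue, one_smul, hy]

omit [IsLocalRing S] in
theorem isSMulRegular_of_ne_zero [IsDomain S] {a : S} (ha : a ≠ 0) :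
    IsSMulRegular (ModuleCat.of S S) a :=
  fun _ _ h => mul_left_cancel₀ ha h

theorem residueToQuotient_add (a : S) (x y : colonMaximal a) :
    residueToQuotient a (x + y) = residueToQuotient a x + residueToQuotient a y := by
  refine residue_linearMap_ext ?_
  rw [LinearMap.add_apply]
  simp only [residueToQuotient_residue, Submodule.coe_add, map_add, smul_add]

theorem residueToQuotient_smul (a r : S) (x : colonMaximal a) :
    residueToQuotient a (r • x) = r • residueToQuotient a x := by
  refine residue_linearMap_ext ?_
  rw [LinearMap.smul_apply]
  simp only [residueToQuotient_residue, Submodule.coe_smul, map_smul, one_smul]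

/-- The class in `Ext¹(S ⧸ a S, S)` of the multiplication by a nonzero `a`. -/
noncomputable def multiplicationClass [IsDomain S] {a : S} (ha : a ≠ 0) :
    Abelian.Ext (ModuleCat.of S (S ⧸ (a • (⊤ : Submodule S S)))) (ModuleCat.of S S) 1 :=
  (isSMulRegular_of_ne_zero ha).smulShortComplex_shortExact.extClass

/-- The connecting map from the socle of `S ⧸ a S` to `Ext¹(k, S)`. -/
noncomputable def socleToExt [IsDomain S] {a : S} (ha : a ≠ 0) : colonMaximal a →ₗ[S] residueExt S 1 where
  toFun y := (Abelian.Ext.mk₀ (ModuleCat.ofHom (residueToQuotient a y))).comp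
    (multiplicationClass ha) (zero_add 1)
  map_add' x y := by
    rw [residueToQuotient_add, ModuleCat.ofHom_add, Abelian.Ext.mk₀_add, Abelian.Ext.add_comp]
  map_smul' r x := by
    have : ModuleCat.ofHom (r • residueToQuotient a x) =
      r • ModuleCat.ofHom (residueToQuotient a x) := rfl
    rw [residueToQuotient_smul, this, Abelian.Ext.mk₀_smul, Abelian.Ext.smul_comp]
    rfl

theorem socleToExt_apply [IsDomain S] {a : S} (ha : a ≠ 0) (y : colonMaximal a) :
    socleToExt ha y = (Abelian.Ext.mk₀ (ModuleCat.ofHom (residueToQuotient a y))).comp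
      (multiplicationClass ha) (zero_add 1) := rfl

/-- By exactness this vanishing places every class in the image of the connecting map. -/
theorem ext_comp_smul_id_eq_zero {a : S} (hm : a ∈ IsLocalRing.maximalIdeal S)
    (e : residueExt S 1) :
    e.comp (Abelian.Ext.mk₀ (a • 𝟙 (ModuleCat.of S S))) (add_zero 1) = 0 := by
  rw [Abelian.Ext.mk₀_smul, Abelian.Ext.comp_smul, Abelian.Ext.comp_mk₀_id]
  exact residueExt_isTorsionBySet S 1 (x := e) (a := ⟨a, hm⟩)

theorem hom_residue_eq_zero [IsDomain S] {a : S} (ha : a ≠ 0)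
    (hm : a ∈ IsLocalRing.maximalIdeal S) (f : IsLocalRing.ResidueField S →ₗ[S] S) : f = 0 := by
  refine residue_linearMap_ext (mul_left_cancel₀ ha ?_)
  rw [← smul_eq_mul, ← map_smul, Algebra.smul_def]
  change f (IsLocalRing.residue S a * _) = a * 0
  rw [(IsLocalRing.residue_eq_zero_iff a).2 hm, zero_mul, map_zero, mul_zero]

theorem socleToExt_surjective [IsDomain S] {a : S} (ha : a ≠ 0)
    (hm : a ∈ IsLocalRing.maximalIdeal S) : Function.Surjective (socleToExt ha) := by
  intro e
  obtain ⟨x, hx⟩ := Abelian.Ext.covariant_sequence_exact₁ _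
    (isSMulRegular_of_ne_zero ha).smulShortComplex_shortExact e (ext_comp_smul_id_eq_zero hm e) (zero_add 1)
  obtain ⟨f, rfl⟩ := Abelian.Ext.addEquiv₀.symm.surjective x
  obtain ⟨y, hy⟩ := exists_residueToQuotient_eq a f.hom
  refine ⟨y, ?_⟩
  rw [← hx, socleToExt_apply, hy]
  rfl

/-- The kernel of the connecting map comes from `Hom(k, S)`, which is zero because `S` is a domain
and `a` kills `k`. -/
theorem socleToExt_eq_zero_iff [IsDomain S] {a : S} (ha : a ≠ 0)
    (hm : a ∈ IsLocalRing.maximalIdeal S) (y : colonMaximal a) :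
    socleToExt ha y = 0 ↔ a ∣ (y : S) := by
  have key : residueToQuotient a y = 0 ↔ a ∣ (y : S) := by
    rw [← mem_smul_top_iff_dvd, ← Submodule.Quotient.mk_eq_zero, ← Submodule.mkQ_apply]
    constructor
    · intro h
      have := residueToQuotient_residue a y 1
      rw [h, one_smul] at this
      exact this.symm
    · intro h
      refine residue_linearMap_ext ?_
      rw [residueToQuotient_residue, h, smul_zero, LinearMap.zero_apply]
  rw [← key]
  constructor
  · intro h
    obtain ⟨x, hx⟩ := Abelian.Ext.covariant_sequence_exact₃ _
      (isSMulRegular_of_ne_zero ha).smulShortComplex_shortExact _ (zero_add 1) h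
    obtain ⟨f, rfl⟩ := Abelian.Ext.addEquiv₀.symm.surjective x
    have hf : f = 0 := ModuleCat.hom_ext (hom_residue_eq_zero ha hm f.hom)
    rw [hf, map_zero, Abelian.Ext.zero_comp] at hx
    have := (Abelian.Ext.mk₀_eq_zero_iff _).1 hx.symm
    exact congrArg ModuleCat.Hom.hom this
  · intro h
    rw [socleToExt_apply, h, ModuleCat.ofHom_zero, Abelian.Ext.mk₀_zero, Abelian.Ext.zero_comp]

theorem residue_smul_residueExt (i : ℕ) (s : S) (e : residueExt S i) :
    IsLocalRing.residue S s • e = s • e := rfl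

/-- If the maximal ideal is generated by a nonzero element, then `Ext¹(k, S)` has dimension at
most one. -/
theorem rank_residueExt_one_le_one [IsDomain S] {a : S} (ha : a ≠ 0)
    (hm : IsLocalRing.maximalIdeal S = Ideal.span {a}) :
    Module.rank (IsLocalRing.ResidueField S) (residueExt S 1) ≤ 1 := by
  have ham : a ∈ IsLocalRing.maximalIdeal S := hm ▸ Ideal.mem_span_singleton_self a
  rw [rank_le_one_iff]
  -- Here `S/aS` is `k` itself, so the class of `1` generates the socle.
  refine ⟨socleToExt ha ⟨1, fun s hs => ?_⟩, fun e => ?_⟩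
  · rw [mul_one]
    exact Ideal.mem_span_singleton.1 (hm ▸ hs)
  · obtain ⟨y, rfl⟩ := socleToExt_surjective ha ham e
    refine ⟨IsLocalRing.residue S (y : S), ?_⟩
    rw [residue_smul_residueExt, ← map_smul]
    congr 1
    ext
    simp

/-- Computation of `dim Ext¹(k, S)` from a coefficient field `K` and a `K`-linear family of
representatives of the socle of `S ⧸ a S`. -/
theorem rank_residueExt_one_eq {K : Type u} [Field K] [Algebra K S] [IsDomain S] {a : S}
    (ha : a ≠ 0) (ham : a ∈ IsLocalRing.maximalIdeal S)
    (hK : Function.Surjective (algebraMap K (IsLocalRing.ResidueField S)))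
    {V : Type u} [AddCommGroup V] [Module K V] (φ : V →ₗ[K] S)
    (hφ : ∀ v, φ v ∈ colonMaximal a) (hinj : ∀ v, a ∣ φ v → v = 0)
    (hsurj : ∀ y ∈ colonMaximal a, ∃ v, a ∣ y - φ v) :
    Module.rank (IsLocalRing.ResidueField S) (residueExt S 1) = Module.rank K V := by
  -- Only additive, since the two sides are vector spaces over different fields; semilinearity along
  -- `K → k` is checked at the end.
  let j : V →+ residueExt S 1 :=
    { toFun := fun v => socleToExt ha ⟨φ v, hφ v⟩
      map_zero' := by
        rw [socleToExt_eq_zero_iff ha ham]; simp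
      map_add' := fun v w => by
        rw [← map_add]; congr 1; ext; simp }
  have hj : Function.Bijective j := by
    constructor
    · rw [injective_iff_map_eq_zero]
      intro v hv
      exact hinj v ((socleToExt_eq_zero_iff ha ham _).1 hv)
    · intro e
      obtain ⟨y, rfl⟩ := socleToExt_surjective ha ham e
      obtain ⟨v, hv⟩ := hsurj y y.2
      refine ⟨v, ?_⟩
      rw [eq_comm, ← sub_eq_zero]
      change socleToExt ha y - socleToExt ha _ = 0
      rw [← map_sub, socleToExt_eq_zero_iff ha ham]
      exact hv
  refine (rank_eq_of_equiv_equiv (algebraMap K (IsLocalRing.ResidueField S))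
    (AddEquiv.ofBijective j hj) ⟨(algebraMap K _).injective, hK⟩ ?_).symm
  intro c v
  have : algebraMap K (IsLocalRing.ResidueField S) c =
      IsLocalRing.residue S (algebraMap K S c) := rfl
  rw [this, residue_smul_residueExt]
  change socleToExt ha _ = _ • socleToExt ha _
  rw [← map_smul]
  congr 1
  ext
  simp [Algebra.smul_def]

end ExtComputation

/-! ### One-dimensional local domains are Cohen–Macaulay -/

section CohenMacaulay

variable {S : Type u} [CommRing S] [IsLocalRing S]

omit [IsLocalRing S] in
theorem ringKrullDim_eq_one_of_dimensionLEOne [IsDomain S] [Ring.DimensionLEOne S]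
    (hS : ¬ IsField S) : ringKrullDim S = 1 := by
  refine le_antisymm ?_ ?_
  · exact (Order.krullDimLE_iff 1 (PrimeSpectrum S)).1 inferInstance
  · rw [← not_lt]
    intro h
    have : Ring.KrullDimLE 0 S := by
      refine (Order.krullDimLE_iff 0 (PrimeSpectrum S)).2 ?_
      exact Order.le_of_lt_succ h
    exact hS Ring.KrullDimLE.isField_of_isDomain

theorem isCohenMacaulayLocalRing_of_dimensionLEOne [IsDomain S] [IsNoetherianRing S]
    [Ring.DimensionLEOne S] (hS : ¬ IsField S) : IsCohenMacaulayLocalRing S := by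
  refine ⟨inferInstance, ?_⟩
  have hdim := ringKrullDim_eq_one_of_dimensionLEOne hS
  rw [hdim]
  have : localDepth S = 1 := by
    refine le_antisymm (iSup_le ?_) ?_
    · rintro ⟨rs, hrs, hreg⟩
      -- A regular sequence lowers the dimension by its length, and the quotient is nonzero, so the
      -- length is at most one.
      have := ringKrullDim_add_length_eq_ringKrullDim_of_isRegular rs hreg
      rw [hdim] at this
      have hnt : Nontrivial (S ⧸ Ideal.ofList rs) := by
        rw [Ideal.Quotient.nontrivial_iff]
        intro h
        refine hreg.top_ne_smul ?_
        rw [h]; simp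
      have h0 : (0 : WithBot ℕ∞) ≤ ringKrullDim (S ⧸ Ideal.ofList rs) :=
        ringKrullDim_nonneg_of_nontrivial
      have h1 : ((rs.length : ℕ∞) : WithBot ℕ∞) ≤ ((1 : ℕ∞) : WithBot ℕ∞) := by
        calc ((rs.length : ℕ∞) : WithBot ℕ∞) = 0 + (rs.length : WithBot ℕ∞) := by
              rw [zero_add]; rfl
          _ ≤ _ := by gcongr
          _ = _ := this
      exact WithBot.coe_le_coe.1 h1
    · obtain ⟨a, ham, ha⟩ := Submodule.exists_mem_ne_zero_of_ne_bot
        (fun h => hS (IsLocalRing.isField_iff_maximalIdeal_eq.2 h))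
      refine le_iSup_of_le ⟨[a], ?_, ?_⟩ ?_
      · simpa using ham
      · rw [IsLocalRing.isRegular_iff_isWeaklyRegular_of_subset_maximalIdeal (by simpa using ham),
          RingTheory.Sequence.isWeaklyRegular_singleton_iff]
        exact isSMulRegular_of_ne_zero ha
      · simp
  rw [this]
  rfl

theorem localType_eq_of_ringKrullDim_eq_one (h : ringKrullDim S = 1) :
    localType S = Cardinal.toENat (Module.rank (IsLocalRing.ResidueField S) (residueExt S 1)) := by
  have : ((ringKrullDim S).unbotD 0).toNat = 1 := by rw [h]; rfl
  unfold localType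
  rw [this]

end CohenMacaulay

/-! ### Structure of the semigroup ring -/

section SemigroupRing

open Polynomial

variable {K : Type u} [Field K] {H : AddSubmonoid ℕ}

/-- Polynomials supported on `H` already form a subalgebra, since `H` is closed under addition. -/
theorem mem_semigroupRing_iff {f : K[X]} :
    f ∈ semigroupRing K H ↔ ∀ i, f.coeff i ≠ 0 → i ∈ H := by
  constructor
  · intro hf
    induction hf using Algebra.adjoin_induction with
    | mem x hx =>
      obtain ⟨h, hh, rfl⟩ := hx
      intro i hi
      rw [coeff_X_pow] at hi
      rwa [show i = h by by_contra hne; simp [hne] at hi]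
    | algebraMap r =>
      intro i hi
      rw [algebraMap_eq, coeff_C] at hi
      rw [show i = 0 by by_contra hne; simp [hne] at hi]
      exact H.zero_mem
    | add x y _ _ hx hy =>
      intro i hi
      by_cases h : x.coeff i = 0
      · exact hy i (by simpa [h] using hi)
      · exact hx i h
    | mul x y _ _ hx hy =>
      intro i hi
      rw [coeff_mul] at hi
      obtain ⟨⟨a, b⟩, hab, hne⟩ := Finset.exists_ne_zero_of_sum_ne_zero hi
      rw [← Finset.HasAntidiagonal.mem_antidiagonal.1 hab]
      exact H.add_mem (hx a (left_ne_zero_of_mul hne)) (hy b (right_ne_zero_of_mul hne))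
  · intro hf
    rw [f.as_sum_support]
    refine Subalgebra.sum_mem _ fun i hi => ?_
    rw [← C_mul_X_pow_eq_monomial, ← smul_eq_C_mul]
    exact (semigroupRing K H).smul_mem
      (Algebra.subset_adjoin ⟨i, hf i (mem_support_iff.1 hi), rfl⟩) _

theorem IsNumericalSemigroup.exists_pos_forall_ge_mem (hH : IsNumericalSemigroup H) :
    ∃ m, 0 < m ∧ ∀ n, m ≤ n → n ∈ H := by
  obtain ⟨b, hb⟩ := hH.bddAbove
  -- The successor keeps the bound positive even when `H = ℕ`.
  refine ⟨b + 1, b.succ_pos, fun n hn => ?_⟩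
  by_contra h
  have := hb h
  omega

theorem X_pow_mem_semigroupRing {h : ℕ} (hh : h ∈ H) : (X ^ h : K[X]) ∈ semigroupRing K H :=
  Algebra.subset_adjoin ⟨h, hh, rfl⟩

/-- The monomial `t ^ h` as an element of the semigroup ring. -/
noncomputable def semigroupMonomial (K : Type u) [Field K] {h : ℕ} (hh : h ∈ H) : semigroupRing K H :=
  ⟨X ^ h, X_pow_mem_semigroupRing hh⟩

@[simp]
theorem coe_semigroupMonomial {h : ℕ} (hh : h ∈ H) :
    (semigroupMonomial K hh : K[X]) = X ^ h := rfl

theorem semigroupMonomial_ne_zero {h : ℕ} (hh : h ∈ H) : semigroupMonomial K hh ≠ 0 :=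
  fun h0 => pow_ne_zero h (X_ne_zero (R := K)) (congrArg Subtype.val h0)

theorem X_pow_mul_mem_semigroupRing {m : ℕ} (hm : ∀ n, m ≤ n → n ∈ H) {n : ℕ} (hn : m ≤ n)
    (f : K[X]) : X ^ n * f ∈ semigroupRing K H := by
  rw [mem_semigroupRing_iff]
  intro i hi
  rw [coeff_X_pow_mul'] at hi
  split_ifs at hi with h
  · exact hm i (hn.trans h)
  · exact absurd rfl hi

theorem semigroupRing_fg (hH : IsNumericalSemigroup H) : (semigroupRing K H).FG := by
  obtain ⟨m, hm0, hm⟩ := hH.exists_pos_forall_ge_mem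
  rw [Subalgebra.fg_def]
  refine ⟨(fun h => (X : K[X]) ^ h) '' {h | h ∈ H ∧ h < 2 * m},
    ((Set.finite_lt_nat (2 * m)).subset fun h hh => hh.2).image _, ?_⟩
  refine le_antisymm (Algebra.adjoin_mono ?_) (Algebra.adjoin_le ?_)
  · rintro _ ⟨h, hh, rfl⟩
    exact ⟨h, hh.1, rfl⟩
  · rintro _ ⟨h, hh, rfl⟩
    induction h using Nat.strong_induction_on with
    | _ h ih =>
      by_cases hlt : h < 2 * m
      · exact Algebra.subset_adjoin ⟨h, ⟨hh, hlt⟩, rfl⟩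
      -- As `h ≥ 2m`, the difference `h - m` is still at least `m`, hence in `H`.
      · rw [show h = m + (h - m) by omega, pow_add]
        exact Subalgebra.mul_mem _
          (Algebra.subset_adjoin ⟨m, ⟨hm m le_rfl, by omega⟩, rfl⟩)
          (ih (h - m) (by omega) (hm _ (by omega)))

theorem isNoetherianRing_semigroupRing (hH : IsNumericalSemigroup H) :
    IsNoetherianRing (semigroupRing K H) :=
  isNoetherianRing_of_fg (semigroupRing_fg hH)

/-- The variable `t` is integral because its power `t^m` lies in `K[H]`. -/
theorem isIntegral_polynomial_semigroupRing (hH : IsNumericalSemigroup H) :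
    Algebra.IsIntegral (semigroupRing K H) K[X] := by
  obtain ⟨m, hm0, hm⟩ := hH.exists_pos_forall_ge_mem
  have hX : IsIntegral (semigroupRing K H) (X : K[X]) :=
    IsIntegral.of_pow hm0 (isIntegral_algebraMap (x := semigroupMonomial K (hm m le_rfl)))
  refine ⟨fun f => ?_⟩
  rw [f.as_sum_support]
  refine IsIntegral.sum _ fun i _ => ?_
  rw [← C_mul_X_pow_eq_monomial]
  exact (isIntegral_algebraMap (x := algebraMap K (semigroupRing K H) (f.coeff i))).mul (hX.pow i)

/-- By lying over, a nonzero prime is contracted from a nonzero prime of the PID `K[t]`; that prime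
is maximal, and maximality descends along integral extensions. -/
theorem dimensionLEOne_semigroupRing (hH : IsNumericalSemigroup H) :
    Ring.DimensionLEOne (semigroupRing K H) := by
  have := isIntegral_polynomial_semigroupRing (K := K) hH
  refine ⟨fun {p} hp0 hp => ?_⟩
  obtain ⟨Q, -, hQ, rfl⟩ := Ideal.exists_ideal_over_prime_of_isIntegral p (⊥ : Ideal K[X]) (by
    intro x hx
    have : x = 0 := Subtype.ext hx
    rw [this]
    exact p.zero_mem)
  have hQ0 : Q ≠ ⊥ := by
    rintro rfl
    refine hp0 (eq_bot_iff.2 fun x hx => ?_)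
    exact Subtype.ext hx
  have := hQ.isMaximal hQ0
  exact Ideal.isMaximal_comap_of_isIntegral_of_isMaximal Q

theorem not_isField_semigroupRing (hH : IsNumericalSemigroup H) :
    ¬ IsField (semigroupRing K H) := by
  obtain ⟨m, hm0, hm⟩ := hH.exists_pos_forall_ge_mem
  intro h
  obtain ⟨y, hy⟩ := h.mul_inv_cancel (semigroupMonomial_ne_zero (K := K) (hm m le_rfl))
  have := congrArg (fun f : semigroupRing K H => (f : K[X]).coeff 0) hy
  simp [hm0.ne] at this

theorem isCohenMacaulayRing_semigroupRing (hH : IsNumericalSemigroup H) :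
    IsCohenMacaulayRing (semigroupRing K H) := by
  have := isNoetherianRing_semigroupRing (K := K) hH
  have := dimensionLEOne_semigroupRing (K := K) hH
  refine ⟨inferInstance, fun p => ?_⟩
  have hp : p.asIdeal ≠ ⊥ := Ring.ne_bot_of_isMaximal_of_not_isField p.isMaximal
    (not_isField_semigroupRing hH)
  have : Ring.DimensionLEOne (Localization.AtPrime p.asIdeal) :=
    Ring.DimensionLEOne.localization _ p.asIdeal.primeCompl_le_nonZeroDivisors
  have : IsNoetherianRing (Localization.AtPrime p.asIdeal) :=
    IsLocalization.isNoetherianRing p.asIdeal.primeCompl _ inferInstance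
  exact isCohenMacaulayLocalRing_of_dimensionLEOne
    (IsLocalization.AtPrime.not_isField _ hp _)

theorem localType_semigroupRing (hH : IsNumericalSemigroup H)
    (p : MaximalSpectrum (semigroupRing K H)) :
    localType (Localization.AtPrime p.asIdeal) = Cardinal.toENat (Module.rank
      (IsLocalRing.ResidueField (Localization.AtPrime p.asIdeal))
      (residueExt (Localization.AtPrime p.asIdeal) 1)) := by
  have := dimensionLEOne_semigroupRing (K := K) hH
  have hp : p.asIdeal ≠ ⊥ := Ring.ne_bot_of_isMaximal_of_not_isField p.isMaximal
    (not_isField_semigroupRing hH)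
  have : Ring.DimensionLEOne (Localization.AtPrime p.asIdeal) :=
    Ring.DimensionLEOne.localization _ p.asIdeal.primeCompl_le_nonZeroDivisors
  exact localType_eq_of_ringKrullDim_eq_one (ringKrullDim_eq_one_of_dimensionLEOne
    (IsLocalization.AtPrime.not_isField _ hp _))

/-! ### The augmentation ideal and the other maximal ideals -/

/-- The constant term, as a ring homomorphism on the semigroup ring. -/
noncomputable def semigroupConstantCoeff (K : Type u) [Field K] (H : AddSubmonoid ℕ) : semigroupRing K H →+* K :=
  constantCoeff.comp (semigroupRing K H).subtype

theorem semigroupConstantCoeff_apply (f : semigroupRing K H) :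
    semigroupConstantCoeff K H f = (f : K[X]).coeff 0 := rfl

theorem semigroupConstantCoeff_algebraMap (c : K) :
    semigroupConstantCoeff K H (algebraMap K _ c) = c := by
  rw [semigroupConstantCoeff_apply]
  exact coeff_C_zero

/-- The maximal ideal of the semigroup ring generated by the monomials of positive degree. -/
noncomputable def augmentationIdeal (K : Type u) [Field K] (H : AddSubmonoid ℕ) :
    MaximalSpectrum (semigroupRing K H) where
  asIdeal := RingHom.ker (semigroupConstantCoeff K H)
  isMaximal := RingHom.ker_isMaximal_of_surjective _ fun c =>
    ⟨algebraMap K _ c, semigroupConstantCoeff_algebraMap c⟩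

theorem mem_augmentationIdeal_iff {f : semigroupRing K H} :
    f ∈ (augmentationIdeal K H).asIdeal ↔ (f : K[X]).coeff 0 = 0 := Iff.rfl

theorem sub_constant_mem_augmentationIdeal (f : semigroupRing K H) :
    f - algebraMap K _ (semigroupConstantCoeff K H f) ∈ (augmentationIdeal K H).asIdeal := by
  change semigroupConstantCoeff K H _ = 0
  rw [map_sub, semigroupConstantCoeff_algebraMap, sub_self]

/-- High powers of elements of the augmentation ideal are divisible by a given monomial. -/
theorem semigroupMonomial_dvd_pow {m : ℕ} (hm : ∀ n, m ≤ n → n ∈ H) {f : semigroupRing K H}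
    (hf : f ∈ (augmentationIdeal K H).asIdeal) :
    semigroupMonomial K (hm m le_rfl) ∣ f ^ (m + m) := by
  obtain ⟨g, hg⟩ := X_dvd_iff.2 (mem_augmentationIdeal_iff.1 hf)
  -- One factor `t^m` is the divisor; the second brings the cofactor into `K[H]`, as `g` need not
  -- lie there.
  refine ⟨⟨X ^ m * g ^ (m + m), X_pow_mul_mem_semigroupRing hm le_rfl _⟩, Subtype.ext ?_⟩
  simp only [SubmonoidClass.coe_pow, hg, MulMemClass.coe_mul, coe_semigroupMonomial]
  rw [mul_pow, pow_add, mul_assoc]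

theorem semigroupMonomial_notMem {m : ℕ} (hm : ∀ n, m ≤ n → n ∈ H)
    {p : MaximalSpectrum (semigroupRing K H)} (hp : p ≠ augmentationIdeal K H) :
    semigroupMonomial K (hm m le_rfl) ∉ p.asIdeal := by
  intro h
  refine hp (MaximalSpectrum.ext ?_)
  refine ((augmentationIdeal K H).isMaximal.eq_of_le p.isMaximal.ne_top fun f hf => ?_).symm
  exact p.isMaximal.isPrime.mem_of_pow_mem _
    (Ideal.mem_of_dvd _ (semigroupMonomial_dvd_pow hm hf) h)

/-- Away from the augmentation ideal the localizations of the semigroup ring have a principal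
maximal ideal. -/
theorem exists_maximalIdeal_eq_span_of_ne (hH : IsNumericalSemigroup H)
    {p : MaximalSpectrum (semigroupRing K H)} (hp : p ≠ augmentationIdeal K H) :
    ∃ a : Localization.AtPrime p.asIdeal, a ≠ 0 ∧
      IsLocalRing.maximalIdeal (Localization.AtPrime p.asIdeal) = Ideal.span {a} := by
  obtain ⟨m, hm0, hm⟩ := hH.exists_pos_forall_ge_mem
  have hs := semigroupMonomial_notMem (K := K) hm hp
  set s := semigroupMonomial K (hm m le_rfl) with hs_def
  -- Multiplication by `t^m`, a unit at `p`, brings any polynomial into `K[H]`. The polynomials it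
  -- sends into `p` form an ideal `P` of the PID `K[t]`, whose generator yields one for the maximal
  -- ideal at `p`.
  let lift : K[X] → semigroupRing K H := fun f =>
    ⟨X ^ m * f, X_pow_mul_mem_semigroupRing hm le_rfl f⟩
  let P : Ideal K[X] :=
    { carrier := {f | lift f ∈ p.asIdeal}
      add_mem' := fun {f g} hf hg => by
        have : lift (f + g) = lift f + lift g := Subtype.ext (mul_add _ _ _)
        change lift (f + g) ∈ p.asIdeal
        exact this ▸ p.asIdeal.add_mem hf hg
      zero_mem' := by
        have : lift 0 = 0 := Subtype.ext (mul_zero _)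
        change lift 0 ∈ p.asIdeal
        exact this ▸ p.asIdeal.zero_mem
      smul_mem' := fun g f hf => by
        -- `lift` is not multiplicative; the extra factor `s` cancels because `p` is prime and `s ∉
        -- p`.
        have : s * lift (g • f) = lift g * lift f := Subtype.ext (by
          change X ^ m * (X ^ m * (g * f)) = X ^ m * g * (X ^ m * f)
          ring)
        refine (p.isMaximal.isPrime.mem_or_mem ?_).resolve_left hs
        rw [this]
        exact p.asIdeal.mul_mem_left _ hf }
  obtain ⟨g, hg⟩ := (IsPrincipalIdealRing.principal P).principal
  have hgP : lift g ∈ p.asIdeal := by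
    have : g ∈ P := hg ▸ Submodule.mem_span_singleton_self g
    exact this
  have hmax : IsLocalRing.maximalIdeal (Localization.AtPrime p.asIdeal) =
      Ideal.span {algebraMap _ _ (lift g)} := by
    rw [← Localization.AtPrime.map_eq_maximalIdeal]
    refine le_antisymm (Ideal.map_le_iff_le_comap.2 fun f hf => ?_) ?_
    · have hfP : (f : K[X]) ∈ P := by
        have : lift f = s * f := rfl
        change lift f ∈ p.asIdeal
        exact this ▸ p.asIdeal.mul_mem_left _ hf
      rw [hg] at hfP
      obtain ⟨q, hq⟩ := Ideal.mem_span_singleton'.1 hfP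
      have hmul : f * (s * s) = lift q * lift g := Subtype.ext (by
        change (f : K[X]) * (X ^ m * X ^ m) = X ^ m * q * (X ^ m * g)
        rw [← hq]
        ring)
      have hunit : IsUnit (algebraMap _ (Localization.AtPrime p.asIdeal) (s * s)) :=
        IsLocalization.map_units _ (⟨s * s, fun h =>
          hs ((p.isMaximal.isPrime.mem_or_mem h).elim id id)⟩ : p.asIdeal.primeCompl)
      rw [Ideal.mem_comap, Ideal.mem_span_singleton, ← hunit.dvd_mul_right, ← map_mul, hmul,
        map_mul]
      exact Dvd.intro_left _ rfl
    · rw [Ideal.span_singleton_le_iff_mem]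
      exact Ideal.mem_map_of_mem _ hgP
  refine ⟨_, fun h0 => ?_, hmax⟩
  have hpne : p.asIdeal ≠ ⊥ := Ring.ne_bot_of_isMaximal_of_not_isField p.isMaximal
    (not_isField_semigroupRing hH)
  refine IsLocalization.AtPrime.not_isField _ hpne (Localization.AtPrime p.asIdeal)
    (IsLocalRing.isField_iff_maximalIdeal_eq.2 ?_)
  rw [hmax, h0, Ideal.span_singleton_eq_bot.2 rfl]

end SemigroupRing

/-! ### Finiteness and existence of pseudo-Frobenius numbers -/

section PseudoFrobenius

variable {H : AddSubmonoid ℕ}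

theorem finite_pseudoFrobenius (hH : IsNumericalSemigroup H) : (pseudoFrobenius H).Finite := by
  obtain ⟨m, hm0, hm⟩ := hH.exists_pos_forall_ge_mem
  refine (Set.finite_Icc (-(m : ℤ)) m).subset fun x hx => ⟨?_, ?_⟩
  · obtain ⟨n, -, hn⟩ := hx.2 m (hm m le_rfl) hm0
    have : (n : ℤ) = x + m := hn
    omega
  · by_contra h
    exact hx.1 ⟨x.toNat, hm _ (by omega), by omega⟩

/-- The largest integer outside `H` qualifies (`-1` when `H = ℕ`). -/
theorem nonempty_pseudoFrobenius (hH : IsNumericalSemigroup H) : (pseudoFrobenius H).Nonempty := by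
  obtain ⟨m, -, hm⟩ := hH.exists_pos_forall_ge_mem
  obtain ⟨x, hx, hmax⟩ := Int.exists_greatest_of_bdd
    (P := fun x : ℤ => x ∉ ((↑) : ℕ → ℤ) '' (H : Set ℕ)) ⟨m, fun z hz => by
      by_contra h
      exact hz ⟨z.toNat, hm _ (by omega), by omega⟩⟩
    ⟨-1, by rintro ⟨n, -, hn⟩; have : (n : ℤ) = -1 := hn; omega⟩
  refine ⟨x, hx, fun h _ h0 => ?_⟩
  by_contra hne
  have := hmax _ hne
  omega

end PseudoFrobenius

/-! ### The socle modulo `t^m` at the augmentation ideal -/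

section Socle

open Polynomial

variable {K : Type u} [Field K] {H : AddSubmonoid ℕ}

theorem semigroupMonomial_dvd_iff {m : ℕ} (hm : m ∈ H) {f : semigroupRing K H} :
    semigroupMonomial K hm ∣ f ↔ ∀ i, (f : K[X]).coeff i ≠ 0 → ∃ j ∈ H, i = j + m := by
  constructor
  · rintro ⟨g, rfl⟩ i hi
    rw [MulMemClass.coe_mul, coe_semigroupMonomial, coeff_X_pow_mul'] at hi
    split_ifs at hi with h
    · exact ⟨i - m, mem_semigroupRing_iff.1 g.2 _ hi, by omega⟩
    · exact absurd rfl hi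
  · intro hf
    obtain ⟨g, hg⟩ : X ^ m ∣ (f : K[X]) := by
      rw [X_pow_dvd_iff]
      intro d hd
      by_contra hne
      obtain ⟨j, -, hj⟩ := hf d hne
      omega
    refine ⟨⟨g, mem_semigroupRing_iff.2 fun i hi => ?_⟩, Subtype.ext hg⟩
    obtain ⟨j, hj, hij⟩ := hf (i + m) (by rwa [hg, coeff_X_pow_mul])
    rwa [show i = j by omega]

/-- Such a `v` is a unit modulo `t^m`: it differs from its constant term `c ≠ 0` by an element
nilpotent modulo `t^m`. Hence divisibility by `t^m` can be tested before localizing. -/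
theorem semigroupMonomial_dvd_of_dvd_mul {m : ℕ} (hm : ∀ n, m ≤ n → n ∈ H)
    {v g : semigroupRing K H} (hv : v ∉ (augmentationIdeal K H).asIdeal)
    (h : semigroupMonomial K (hm m le_rfl) ∣ v * g) : semigroupMonomial K (hm m le_rfl) ∣ g := by
  set c := algebraMap K (semigroupRing K H) (semigroupConstantCoeff K H v) with hc
  have hcu : IsUnit c := (IsUnit.mk0 _ fun h0 => hv h0).map _
  have h1 : semigroupMonomial K (hm m le_rfl) ∣ (c - v) ^ (m + m) := by
    refine semigroupMonomial_dvd_pow hm ?_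
    rw [← neg_sub]
    exact neg_mem (sub_constant_mem_augmentationIdeal v)
  have h2 : v ∣ c ^ (m + m) - (c - v) ^ (m + m) := by
    simpa using sub_dvd_pow_sub_pow c (c - v) (m + m)
  have h3 : semigroupMonomial K (hm m le_rfl) ∣ (c ^ (m + m) - (c - v) ^ (m + m)) * g :=
    h.trans (mul_dvd_mul_right h2 g)
  have h4 := dvd_add h3 (h1.mul_right g)
  rw [← add_mul, sub_add_cancel] at h4
  exact ((hcu.pow (m + m)).dvd_mul_left).1 h4

theorem algebraMap_dvd_algebraMap_iff {m : ℕ} (hm : ∀ n, m ≤ n → n ∈ H)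
    {g : semigroupRing K H} :
    algebraMap _ (Localization.AtPrime (augmentationIdeal K H).asIdeal)
      (semigroupMonomial K (hm m le_rfl)) ∣ algebraMap _ _ g ↔
        semigroupMonomial K (hm m le_rfl) ∣ g := by
  refine ⟨fun h => ?_, fun h => map_dvd _ h⟩
  obtain ⟨y, hy⟩ := h
  obtain ⟨⟨r, u⟩, hr⟩ := IsLocalization.surj (augmentationIdeal K H).asIdeal.primeCompl y
  refine semigroupMonomial_dvd_of_dvd_mul hm u.2 ⟨r, ?_⟩
  refine IsLocalization.injective (Localization.AtPrime (augmentationIdeal K H).asIdeal)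
    (augmentationIdeal K H).asIdeal.primeCompl_le_nonZeroDivisors ?_
  rw [map_mul, map_mul, ← hr, hy]
  ring

theorem residue_algebraMap_eq {R : Type*} [CommRing R] (p : Ideal R) [p.IsPrime] {f g : R}
    (h : f - g ∈ p) : IsLocalRing.residue _ (algebraMap R (Localization.AtPrime p) f) =
      IsLocalRing.residue _ (algebraMap R (Localization.AtPrime p) g) := by
  rw [← sub_eq_zero, ← map_sub, ← map_sub, IsLocalRing.residue_eq_zero_iff,
    IsLocalization.AtPrime.to_map_mem_maximal_iff _ p]
  exact h

/-- Replaces the fraction `y = r/u` by the ring element `d * r`. When `c` is the constant term of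
`u`, the error is `y` times an element of the maximal ideal, so it is negligible for `y` in the
colon ideal. -/
theorem sub_algebraMap_mul_eq {R S : Type*} [CommRing R] [CommRing S] [Algebra R S] {y : S}
    {r u c d : R} (h : y * algebraMap R S u = algebraMap R S r) (hcd : d * c = 1) :
    y - algebraMap R S (d * r) = algebraMap R S (-d * (u - c)) * y := by
  have h2 : algebraMap R S d * algebraMap R S c = 1 := by rw [← map_mul, hcd, map_one]
  rw [map_mul, ← h, map_mul, map_neg, map_sub]
  linear_combination (-y) * h2

theorem algebraMap_residueField_surjective :
    Function.Surjective (algebraMap K (IsLocalRing.ResidueField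
      (Localization.AtPrime (augmentationIdeal K H).asIdeal))) := by
  intro x
  obtain ⟨y, rfl⟩ := IsLocalRing.residue_surjective x
  obtain ⟨⟨r, u⟩, hr⟩ := IsLocalization.surj (augmentationIdeal K H).asIdeal.primeCompl y
  have key : ∀ f : semigroupRing K H, IsLocalRing.residue _ (algebraMap _
      (Localization.AtPrime (augmentationIdeal K H).asIdeal) f) =
        algebraMap K _ (semigroupConstantCoeff K H f) := by
    intro f
    have h1 : algebraMap K (IsLocalRing.ResidueField
      (Localization.AtPrime (augmentationIdeal K H).asIdeal)) (semigroupConstantCoeff K H f) =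
      IsLocalRing.residue _ (algebraMap _ (Localization.AtPrime (augmentationIdeal K H).asIdeal)
        (algebraMap K (semigroupRing K H) (semigroupConstantCoeff K H f))) := rfl
    rw [h1]
    exact residue_algebraMap_eq _ (sub_constant_mem_augmentationIdeal f)
  have hu : semigroupConstantCoeff K H u ≠ 0 := fun h0 => u.2 h0
  have hu' : algebraMap K (IsLocalRing.ResidueField
      (Localization.AtPrime (augmentationIdeal K H).asIdeal)) (semigroupConstantCoeff K H u) ≠ 0 :=
    fun h0 => hu ((map_eq_zero _).1 h0)
  refine ⟨semigroupConstantCoeff K H r / semigroupConstantCoeff K H u, ?_⟩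
  rw [map_div₀, div_eq_iff hu', ← key, ← key, ← map_mul, hr]

variable (K) in
/-- The `K`-linear combinations of the monomials `t ^ (x + m)`, for `x` in `PF(H)`. -/
noncomputable def pseudoFrobeniusCombination [Fintype (pseudoFrobenius H)] {e : pseudoFrobenius H → ℕ}
    (he : ∀ x, e x ∈ H) : (pseudoFrobenius H → K) →ₗ[K] semigroupRing K H :=
  Fintype.linearCombination K fun x => semigroupMonomial K (he x)

theorem coeff_pseudoFrobeniusCombination [Fintype (pseudoFrobenius H)]
    {e : pseudoFrobenius H → ℕ} (he : ∀ x, e x ∈ H) (v : pseudoFrobenius H → K) (i : ℕ) :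
    (pseudoFrobeniusCombination K he v : K[X]).coeff i = ∑ x, if i = e x then v x else 0 := by
  rw [pseudoFrobeniusCombination, Fintype.linearCombination_apply, AddSubmonoidClass.coe_finsetSum,
    finsetSum_coeff]
  refine Finset.sum_congr rfl fun x _ => ?_
  change (v x • (X ^ e x : K[X])).coeff i = _
  rw [coeff_smul, coeff_X_pow, smul_eq_mul, mul_ite, mul_one, mul_zero]

theorem coeff_pseudoFrobeniusCombination_apply [Fintype (pseudoFrobenius H)]
    {e : pseudoFrobenius H → ℕ} (he : ∀ x, e x ∈ H) (hinj : Function.Injective e)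
    (v : pseudoFrobenius H → K) (x : pseudoFrobenius H) :
    (pseudoFrobeniusCombination K he v : K[X]).coeff (e x) = v x := by
  rw [coeff_pseudoFrobeniusCombination, Finset.sum_eq_single x]
  · simp
  · intro y _ hy
    rw [if_neg fun h => hy (hinj h).symm]
  · simp

theorem exists_eq_of_coeff_pseudoFrobeniusCombination_ne_zero [Fintype (pseudoFrobenius H)]
    {e : pseudoFrobenius H → ℕ} (he : ∀ x, e x ∈ H) {v : pseudoFrobenius H → K} {i : ℕ}
    (hi : (pseudoFrobeniusCombination K he v : K[X]).coeff i ≠ 0) : ∃ x, i = e x := by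
  rw [coeff_pseudoFrobeniusCombination] at hi
  obtain ⟨x, -, hx⟩ := Finset.exists_ne_zero_of_sum_ne_zero hi
  exact ⟨x, by by_contra h; simp [h] at hx⟩

theorem rank_residueExt_augmentationIdeal (hH : IsNumericalSemigroup H) :
    Module.rank (IsLocalRing.ResidueField (Localization.AtPrime (augmentationIdeal K H).asIdeal))
      (residueExt (Localization.AtPrime (augmentationIdeal K H).asIdeal) 1) =
        ((pseudoFrobenius H).ncard : Cardinal) := by
  obtain ⟨m, hm0, hm⟩ := hH.exists_pos_forall_ge_mem
  have : Fintype (pseudoFrobenius H) := (finite_pseudoFrobenius hH).fintype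
  -- Since `m` is a positive element of `H`, the possibly negative `x` becomes an exponent `x + m`
  -- in `H`.
  have hex : ∀ x : pseudoFrobenius H, ∃ n ∈ H, (n : ℤ) = x + m := fun x =>
    x.2.2 m (hm m le_rfl) hm0
  choose e he hem using hex
  have hinj : Function.Injective e := fun x y hxy => Subtype.ext (by
    have h1 := hem x
    have h2 := hem y
    rw [hxy] at h1
    omega)
  set p := (augmentationIdeal K H).asIdeal
  set xm := semigroupMonomial K (hm m le_rfl) with hxm
  have hloc : Function.Injective (algebraMap (semigroupRing K H) (Localization.AtPrime p)) :=
    IsLocalization.injective (Localization.AtPrime p) p.primeCompl_le_nonZeroDivisors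
  have hmem : ∀ f : semigroupRing K H, algebraMap _ (Localization.AtPrime p) f ∈
      IsLocalRing.maximalIdeal (Localization.AtPrime p) ↔ f ∈ p :=
    fun f => IsLocalization.AtPrime.to_map_mem_maximal_iff _ p f
  have hxp : xm ∈ p := mem_augmentationIdeal_iff.2 (by simp [hxm, hm0.ne])
  rw [rank_residueExt_one_eq (K := K) (a := algebraMap _ (Localization.AtPrime p) xm) ?_ ?_
    algebraMap_residueField_surjective
    ((IsScalarTower.toAlgHom K (semigroupRing K H) (Localization.AtPrime p)).toLinearMap ∘ₗ
      pseudoFrobeniusCombination K he) ?_ ?_ ?_]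
  · rw [rank_fun', ← Nat.card_eq_fintype_card]
    rfl
  · exact fun h => semigroupMonomial_ne_zero _ (hloc (h.trans (map_zero _).symm))
  · exact (hmem xm).2 hxp
  · intro v s hs
    change _ ∣ s * algebraMap _ _ (pseudoFrobeniusCombination K he v)
    obtain ⟨⟨r, u⟩, hr⟩ := IsLocalization.surj p.primeCompl s
    have hrp : r ∈ p := by
      rw [← hmem, ← hr]
      exact Ideal.mul_mem_right _ _ hs
    -- Clearing the denominator of `s` leaves a divisibility in `K[H]`, read off from exponents: `a
    -- + (x + m) = (x + a) + m` with `x + a ∈ H`.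
    rw [← (IsLocalization.map_units (Localization.AtPrime p) u).dvd_mul_left, ← mul_assoc,
      mul_comm _ s, hr, ← map_mul, algebraMap_dvd_algebraMap_iff, semigroupMonomial_dvd_iff]
    intro i hi
    rw [MulMemClass.coe_mul, coeff_mul] at hi
    obtain ⟨⟨a, b⟩, hab, hne⟩ := Finset.exists_ne_zero_of_sum_ne_zero hi
    have hab : a + b = i := Finset.HasAntidiagonal.mem_antidiagonal.1 hab
    have ha := left_ne_zero_of_mul hne
    obtain ⟨x, hx⟩ := exists_eq_of_coeff_pseudoFrobeniusCombination_ne_zero he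
      (right_ne_zero_of_mul hne)
    have ha0 : 0 < a := Nat.pos_of_ne_zero fun h0 => by
      change (r : K[X]).coeff a ≠ 0 at ha
      exact ha (h0 ▸ mem_augmentationIdeal_iff.1 hrp)
    obtain ⟨n, hn, hnx⟩ := x.2.2 a (mem_semigroupRing_iff.1 r.2 a ha) ha0
    have hnx : (n : ℤ) = x + a := hnx
    have := hem x
    have hx : b = e x := hx
    exact ⟨n, hn, by omega⟩
  · intro v hv
    replace hv := (semigroupMonomial_dvd_iff _).1 ((algebraMap_dvd_algebraMap_iff hm).1 hv)
    ext x
    by_contra hne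
    obtain ⟨j, hj, hij⟩ := hv (e x)
      (by rwa [coeff_pseudoFrobeniusCombination_apply he hinj])
    have := hem x
    exact x.2.1 ⟨j, hj, by omega⟩
  · intro y hy
    obtain ⟨⟨r, u⟩, hr⟩ := IsLocalization.surj p.primeCompl y
    have hu0 : semigroupConstantCoeff K H u ≠ 0 := fun h0 => u.2 h0
    set c := algebraMap K (semigroupRing K H) (semigroupConstantCoeff K H u) with hc
    set d := algebraMap K (semigroupRing K H) (semigroupConstantCoeff K H u)⁻¹ with hd
    have hcd : d * c = 1 := by rw [hc, hd, ← map_mul, inv_mul_cancel₀ hu0, map_one]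
    have h1 : algebraMap _ (Localization.AtPrime p) xm ∣ y - algebraMap _ _ (d * r) := by
      refine (sub_algebraMap_mul_eq (S := Localization.AtPrime p) hr hcd).symm ▸ ?_
      exact hy _ ((hmem _).2 (p.mul_mem_left _ (sub_constant_mem_augmentationIdeal _)))
    set f := d * r
    -- Multiplication by `t^h` only shifts exponents, so the socle condition on `f` holds for each
    -- of its monomials separately.
    have h2 : ∀ i, (f : K[X]).coeff i ≠ 0 → ∀ h ∈ H, 0 < h → ∃ j ∈ H, i + h = j + m := by
      intro i hi h hh h0
      have h3 : xm ∣ semigroupMonomial K hh * f := by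
        rw [← algebraMap_dvd_algebraMap_iff, map_mul]
        have h4 : algebraMap _ (Localization.AtPrime p) (semigroupMonomial K hh) ∈
            IsLocalRing.maximalIdeal (Localization.AtPrime p) :=
          (hmem _).2 (mem_augmentationIdeal_iff.2 (by simp [h0.ne]))
        have h5 := dvd_sub (hy _ h4) (h1.mul_left (algebraMap _ _ (semigroupMonomial K hh)))
        convert h5 using 1
        ring
      refine (semigroupMonomial_dvd_iff _).1 h3 (i + h) ?_
      rwa [MulMemClass.coe_mul, coe_semigroupMonomial, coeff_X_pow_mul]
    refine ⟨fun x => (f : K[X]).coeff (e x), ?_⟩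
    change _ ∣ y - algebraMap _ _ (pseudoFrobeniusCombination K he _)
    have h3 : xm ∣ f - pseudoFrobeniusCombination K he fun x => (f : K[X]).coeff (e x) := by
      rw [semigroupMonomial_dvd_iff]
      intro i hi
      rw [AddSubgroupClass.coe_sub, coeff_sub] at hi
      by_cases hie : ∃ x, i = e x
      · obtain ⟨x, rfl⟩ := hie
        rw [coeff_pseudoFrobeniusCombination_apply he hinj, sub_self] at hi
        exact absurd rfl hi
      · have h4 : (pseudoFrobeniusCombination K he fun x => (f : K[X]).coeff (e x) :
            K[X]).coeff i = 0 := by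
          by_contra hne
          exact hie (exists_eq_of_coeff_pseudoFrobeniusCombination_ne_zero he hne)
        rw [h4, sub_zero] at hi
        -- An exponent `i` of `f` with `i - m ∉ H` makes `i - m` pseudo-Frobenius, so `i` would be
        -- some `e x`.
        by_contra hno
        refine hie ⟨⟨(i : ℤ) - m, ?_, fun h hh h0 => ?_⟩, ?_⟩
        · rintro ⟨j, hj, hji⟩
          have hji : (j : ℤ) = i - m := hji
          exact hno ⟨j, hj, by omega⟩
        · obtain ⟨j, hj, hij⟩ := h2 i hi h hh h0
          exact ⟨j, hj, by omega⟩
        · zify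
          rw [hem]
          simp
    have h4 := dvd_add h1 (map_dvd (algebraMap _ (Localization.AtPrime p)) h3)
    rwa [map_sub, sub_add_sub_cancel] at h4

theorem cohenMacaulayType_semigroupRing (hH : IsNumericalSemigroup H) :
    cohenMacaulayType (semigroupRing K H) = numericalSemigroupType H := by
  have h0 : localType (Localization.AtPrime (augmentationIdeal K H).asIdeal) =
      numericalSemigroupType H := by
    rw [localType_semigroupRing hH, rank_residueExt_augmentationIdeal hH, map_natCast]
    rfl
  refine le_antisymm (iSup_le fun p => ?_) (h0 ▸ le_iSup (fun p : MaximalSpectrum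
    (semigroupRing K H) => localType (Localization.AtPrime p.asIdeal)) (augmentationIdeal K H))
  by_cases hp : p = augmentationIdeal K H
  · exact hp ▸ h0.le
  · obtain ⟨a, ha, hmax⟩ := exists_maximalIdeal_eq_span_of_ne hH hp
    rw [localType_semigroupRing hH]
    calc _ ≤ Cardinal.toENat 1 := OrderHomClass.mono _ (rank_residueExt_one_le_one ha hmax)
      _ = ((1 : ℕ) : ℕ∞) := by simp
      _ ≤ _ := Nat.cast_le.2 ((Set.ncard_pos (finite_pseudoFrobenius hH)).2
        (nonempty_pseudoFrobenius hH))

end Socle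

theorem theorem3p1 (K : Type*) [Field K] (H : AddSubmonoid ℕ) (hH : IsNumericalSemigroup H) :
    (pseudoFrobenius H).Finite ∧
    IsCohenMacaulayRing (semigroupRing K H) ∧
    (numericalSemigroupType H : ℕ∞) = cohenMacaulayType (semigroupRing K H) :=
  ⟨finite_pseudoFrobenius hH, isCohenMacaulayRing_semigroupRing hH,
    (cohenMacaulayType_semigroupRing hH).symm⟩
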